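/- Let $G$ be a finite unsigned graph (loops and multiple edges allowed). Its chromatic symmetric function is the formal power series over $\mathbb{Q}$ in the variables $x_0,x_1,x_2,\dots$ $$X_G=\sum_{\kappa}\ \prod_{v\in V(G)}x_{\kappa(v)},$$ the sum being over all proper colorings $\kappa:V(G)\to\mathbb{N}=\{0,1,2,\dots\}$, that is, $\kappa(u)\neq\kappa(v)$ whenever $u$ and $v$ are the ends of an edge. For $a\ge 1$ let $p_a=\sum_{i\ge 0}x_i^a$, and for $n\ge 1$ let $\zeta_n=\sum_{a=1}^n\binom{n}{a}p_a$. Then $X_G$ can be written in exactly one way as a polynomial, with rational coefficients, in $\zeta_1,\zeta_2,\dots$: $$X_G=\sum_{m}c_m\prod_{n\ge 1}\zeta_n^{m_n},$$ where $m=(m_1,m_2,\dots)$ runs over finitely supported sequences of nonnegative integers and only finitely many $c_m$ are nonzero. For every integer $k\ge 0$, the number of acyclic orientations of $G$ with exactly $k$ sinks is $$\sum_{m\,:\,\sum_{n} n\,m_n=k}c_m,$$ the sum of the coefficients of those terms whose $\zeta$-indices, counted with multiplicity, sum to $k$. Here an orientation directs every edge from one of its ends to the other, it is acyclic if it has no directed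 cycle (a loop counts as a directed cycle), and a sink is a vertex with no outgoing edge (so isolated vertices are sinks). -/

import Mathlib

noncomputable section

namespace Graph

variable {α β : Type*}

/-- A proper coloring of the (multi)graph `G` with colors in `ℕ`: the two ends of every edge get
different colors. In particular a graph with a loop has no proper coloring. -/
def IsProperColoring (G : Graph α β) (κ : G.vertexSet → ℕ) : Prop :=
  ∀ (e : β) (u v : G.vertexSet), G.IsLink e u v → κ u ≠ κ v

/-- The monomial `∏ v, x_{κ v}`, as an exponent vector. -/
def coloringMonomial (G : Graph α β) [Fintype G.vertexSet] (κ : G.vertexSet → ℕ) : ℕ →₀ ℕ :=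
  ∑ v, Finsupp.single (κ v) 1

/-- The chromatic symmetric function `X_G = ∑ κ, ∏ v, x_{κ v}`, the sum being over all proper
colorings `κ`, as a formal power series in `x_0, x_1, x_2, …`: the coefficient of a monomial is the
(finite) number of proper colorings that contribute this monomial. -/
def chromaticSymm (G : Graph α β) [Fintype G.vertexSet] : MvPowerSeries ℕ ℚ :=
  fun m => (Nat.card {κ : G.vertexSet → ℕ // G.IsProperColoring κ ∧ G.coloringMonomial κ = m} : ℚ)

/-- An orientation of `G`: every edge is given a direction, from one of its ends (the tail) to its
other end (the head). -/
structure Orientation (G : Graph α β) where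
  tail : G.edgeSet → G.vertexSet
  head : G.edgeSet → G.vertexSet
  isLink : ∀ e : G.edgeSet, G.IsLink e (tail e) (head e)

namespace Orientation

variable {G : Graph α β}

/-- Some edge is directed from `u` to `v`. -/
def Arc (o : G.Orientation) (u v : G.vertexSet) : Prop :=
  ∃ e, o.tail e = u ∧ o.head e = v

/-- There is no directed closed walk of positive length (so a directed loop counts as a cycle). -/
def IsAcyclic (o : G.Orientation) : Prop :=
  ∀ v, ¬ Relation.TransGen o.Arc v v

/-- A sink is a vertex at which all arrows point towards it, i.e. no edge leaves it;
isolated vertices are sinks. -/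
def IsSink (o : G.Orientation) (v : G.vertexSet) : Prop :=
  ∀ e, o.tail e ≠ v

end Orientation

/-- The number of acyclic orientations of `G` with exactly `k` sinks. -/
def acyclicOrientationCount (G : Graph α β) (k : ℕ) : ℕ :=
  Nat.card {o : G.Orientation // o.IsAcyclic ∧ Nat.card {v // o.IsSink v} = k}

end Graph

/-- The power sum `p_a = ∑ i, x_i ^ a` (for `a ≥ 1`), as a formal power series in
`x_0, x_1, x_2, …`: the coefficient of a monomial is the number of `i` for which `x_i ^ a` is this
monomial. -/
def powerSumSeries (a : ℕ) : MvPowerSeries ℕ ℚ :=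
  fun m => (Nat.card {i : ℕ // Finsupp.single i a = m} : ℚ)

/-- `ζ_n = ∑_{a=1}^n C(n,a) p_a`, for `n ≥ 1`. -/
def zetaSeries (n : ℕ+) : MvPowerSeries ℕ ℚ :=
  ∑ a ∈ Finset.Icc 1 (n : ℕ), ((n : ℕ).choose a : ℚ) • powerSumSeries a

/-- The sum of the indices, with multiplicity, of the factors of the monomial `∏ n, ζ_n ^ m n`. -/
def indexSum (m : ℕ+ →₀ ℕ) : ℕ :=
  m.sum fun n c => c * (n : ℕ)

/-- The sum of the coefficients of those terms of `P` whose indices sum to `k`. -/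
def coeffSum (P : MvPolynomial ℕ+ ℚ) (k : ℕ) : ℚ :=
  ∑ m ∈ P.support with indexSum m = k, P.coeff m

end

/-!
The edge relation `r` on the vertex set carries all the information: colorings only see `r`, and an
acyclic orientation directs parallel edges alike, so it amounts to an acyclic relation that contains
one of the two directions of every edge (`acyclicOrientationCount_eq`). A loop makes both sides
vanish.

*Existence and uniqueness.* Inclusion-exclusion over monochromatic edges gives Stanley's expansion
`X_G = ∑ S, (-1) ^ |S| ∏ c, p_{|c|}` over edge sets `S` and their components `c`
(`coeff_aeval_powerSumPoly`). The power sums are algebraically independent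
(`aeval_powerSumSeries_injective`), and binomial inversion passes between the `p_a` and the `ζ_n`:
identify linear forms in the generators with polynomials in `t` modulo constants, the `n`-th
generator being `t ^ n`; the change of generators is then `t ↦ t + 1`, with inverse `t ↦ t - 1`
(`shift_shift_neg`).

*Counting sinks.* The sum of the coefficients with index sum `k` is the coefficient of `t ^ k` after
the substitution `ζ_n ↦ t ^ n`, that is, `p_a ↦ (t - 1) ^ a - (-1) ^ a`
(`aeval_X_pow_shift_neg_one`). This specializes `p_a ↦ q ^ a + z u ^ a`, which for a natural number
`z` means one color of weight `q` and `z` colors of weight `u`. Splitting off the first color class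
`A`, a stable set, and extending from natural `z` to all `z` by polynomiality gives
`aeval_powerSumPoly_add`:

  `X_G(q ^ a + z u ^ a) = ∑ A, q ^ |A| X_{G - A}(z u ^ a)`.

The generating function of acyclic orientations satisfies the parallel identity
`∑ o, (q + 1) ^ |sinks o| = ∑ A, q ^ |A| ao(G - A)` (`sum_add_one_pow_card_sinks`), because the
acyclic orientations whose sinks include a stable set `A` are those of `G - A`. For `q = -1` both
sums vanish on nonempty graphs, as an acyclic orientation has a sink; by induction
`X_G(-(-1) ^ a) = ao(G)` (`aeval_powerSumPoly_neg_one`), which is Stanley's theorem on acyclic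
orientations. For `q = t - 1` the two identities then agree term by term, which gives the theorem.
-/

namespace Chromatic

open Finset MvPolynomial

noncomputable section

open scoped Classical

/-! ### Acyclic orientations of a relation -/

section Orientations

variable {V : Type*}

/-- The relation `o` is an acyclic orientation of the symmetric relation `r`: it keeps one of the
two directions of every edge and has no directed cycle. A relation with a loop has none. -/
structure IsAcyclicOrientation (r o : V → V → Prop) : Prop where
  le : ∀ u v, o u v → r u v
  total : ∀ u v, r u v → o u v ∨ o v u
  acyclic : ∀ v, ¬ Relation.TransGen o v v

/-- A set of vertices no two of which (equal or not) are related. -/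
def IsStable (r : V → V → Prop) (A : Finset V) : Prop :=
  ∀ u ∈ A, ∀ v ∈ A, ¬ r u v

theorem isStable_empty (r : V → V → Prop) : IsStable r ∅ := by
  simp [IsStable]

/-- The relation induced by `r` on the complement of `A`. -/
abbrev deleteSet (r : V → V → Prop) (A : Finset V) (u v : {v // v ∉ A}) : Prop :=
  r u v

/-- Extend a relation on the complement of `A` to all vertices, by directing into `A` every edge
of `r` between `A` and its complement. -/
def extendInto (r : V → V → Prop) (A : Finset V) (o : {v // v ∉ A} → {v // v ∉ A} → Prop)
    (u v : V) : Prop :=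
  ∃ hu : u ∉ A, if hv : v ∉ A then o ⟨u, hu⟩ ⟨v, hv⟩ else r u v

theorem deleteSet_extendInto (r : V → V → Prop) (A : Finset V)
    (o : {v // v ∉ A} → {v // v ∉ A} → Prop) : deleteSet (extendInto r A o) A = o := by
  ext ⟨u, hu⟩ ⟨v, hv⟩
  simp [deleteSet, extendInto, hu, hv]

theorem transGen_of_extendInto {r : V → V → Prop} {A : Finset V}
    {o : {v // v ∉ A} → {v // v ∉ A} → Prop} {u v : V}
    (h : Relation.TransGen (extendInto r A o) u v) (hu : u ∉ A) (hv : v ∉ A) :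
    Relation.TransGen o ⟨u, hu⟩ ⟨v, hv⟩ := by
  induction h with
  | single h =>
    obtain ⟨_, h⟩ := h
    rw [dif_pos hv] at h
    exact .single h
  | tail _ h ih =>
    obtain ⟨hb, h⟩ := h
    rw [dif_pos hv] at h
    exact (ih hb).tail h

theorem IsAcyclicOrientation.extendInto {r : V → V → Prop} (hr : ∀ u v, r u v → r v u)
    {A : Finset V} (hA : IsStable r A) {o : {v // v ∉ A} → {v // v ∉ A} → Prop}
    (ho : IsAcyclicOrientation (deleteSet r A) o) :
    IsAcyclicOrientation r (extendInto r A o) where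
  le u v := by
    rintro ⟨hu, h⟩
    split_ifs at h with hv
    · exact h
    · exact ho.le _ _ h
  total u v h := by
    by_cases hu : u ∈ A <;> by_cases hv : v ∈ A
    · exact (hA u hu v hv h).elim
    · exact .inr ⟨hv, by simpa [hu] using hr _ _ h⟩
    · exact .inl ⟨hu, by simpa [hv] using h⟩
    · refine (ho.total ⟨u, hu⟩ ⟨v, hv⟩ h).imp (fun h => ⟨hu, ?_⟩) (fun h => ⟨hv, ?_⟩)
      · simpa [hv] using h
      · simpa [hu] using h
  acyclic v h := by
    have hv : v ∉ A := by
      obtain ⟨_, ⟨hv, _⟩, _⟩ := Relation.TransGen.head'_iff.1 h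
      exact hv
    exact ho.acyclic _ (transGen_of_extendInto h hv hv)

theorem IsAcyclicOrientation.deleteSet {r o : V → V → Prop} (ho : IsAcyclicOrientation r o)
    (A : Finset V) : IsAcyclicOrientation (deleteSet r A) (deleteSet o A) where
  le _ _ := ho.le _ _
  total _ _ := ho.total _ _
  acyclic v h := ho.acyclic v (h.lift Subtype.val fun _ _ => id)

variable [Fintype V]

/-- The acyclic orientations of `r`, as a finite set of relations. -/
def acyclicOrientations (r : V → V → Prop) : Finset (V → V → Prop) :=
  univ.filter (IsAcyclicOrientation r)

/-- The vertices that no arc leaves. -/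
def sinks (o : V → V → Prop) : Finset V :=
  univ.filter fun v => ∀ u, ¬ o v u

theorem mem_sinks {o : V → V → Prop} {v : V} : v ∈ sinks o ↔ ∀ u, ¬ o v u := by
  simp [sinks]

theorem extendInto_deleteSet {r o : V → V → Prop}
    (ho : IsAcyclicOrientation r o) {A : Finset V} (hA : A ⊆ sinks o) :
    extendInto r A (deleteSet o A) = o := by
  have hs : ∀ v ∈ A, ∀ u, ¬ o v u := fun v hv => by simpa [sinks] using hA hv
  ext u v
  constructor
  · rintro ⟨hu, h⟩
    split_ifs at h with hv
    · exact (ho.total u v h).resolve_right (hs v hv u)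
    · exact h
  · intro h
    have hu : u ∉ A := fun hu => hs u hu v h
    refine ⟨hu, ?_⟩
    split_ifs with hv
    · exact ho.le _ _ h
    · exact h

theorem subset_sinks_extendInto (r : V → V → Prop) (A : Finset V)
    (o : {v // v ∉ A} → {v // v ∉ A} → Prop) : A ⊆ sinks (extendInto r A o) := by
  intro v hv
  simp only [sinks, mem_filter, mem_univ, true_and]
  rintro u ⟨h, _⟩
  exact h hv

theorem isStable_of_subset_sinks {r o : V → V → Prop} (ho : IsAcyclicOrientation r o)
    {A : Finset V} (hA : A ⊆ sinks o) : IsStable r A := by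
  intro u hu v hv h
  have hs : ∀ v ∈ A, ∀ u, ¬ o v u := fun v hv => by simpa [sinks] using hA hv
  exact (ho.total u v h).elim (hs u hu v) (hs v hv u)

/-- The acyclic orientations in which all vertices of a stable set `A` are sinks are those of the
graph without `A`. -/
theorem card_filter_subset_sinks {r : V → V → Prop} (hr : ∀ u v, r u v → r v u) {A : Finset V}
    (hA : IsStable r A) :
    #{o ∈ acyclicOrientations r | A ⊆ sinks o} = #(acyclicOrientations (deleteSet r A)) := by
  refine Finset.card_nbij' (fun o => deleteSet o A) (extendInto r A) ?_ ?_ ?_ ?_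
  · intro o ho
    simp only [acyclicOrientations, coe_filter, mem_filter, mem_univ, true_and,
      Set.mem_ofPred_eq] at ho ⊢
    exact ho.1.deleteSet A
  · intro o ho
    simp only [acyclicOrientations, coe_filter, mem_filter, mem_univ, true_and,
      Set.mem_ofPred_eq] at ho ⊢
    exact ⟨ho.extendInto hr hA, subset_sinks_extendInto r A o⟩
  · intro o ho
    simp only [acyclicOrientations, coe_filter, mem_filter, mem_univ, true_and,
      Set.mem_ofPred_eq] at ho
    exact extendInto_deleteSet ho.1 ho.2
  · intro o _
    exact deleteSet_extendInto r A o

/-- The generating function of acyclic orientations by their number of sinks: expand the power of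
`q + 1` over the subsets `A` of the set of sinks, and count the orientations for each `A`. -/
theorem sum_add_one_pow_card_sinks {R : Type*} [CommRing R] {r : V → V → Prop}
    (hr : ∀ u v, r u v → r v u) (q : R) :
    ∑ o ∈ acyclicOrientations r, (q + 1) ^ #(sinks o) =
      ∑ A : Finset V with IsStable r A, q ^ #A * (#(acyclicOrientations (deleteSet r A)) : R) := by
  calc ∑ o ∈ acyclicOrientations r, (q + 1) ^ #(sinks o)
      = ∑ o ∈ acyclicOrientations r, ∑ A : Finset V, if A ⊆ sinks o then q ^ #A else 0 := by
        refine sum_congr rfl fun o _ => ?_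
        rw [← sum_pow_mul_eq_add_pow, ← sum_filter]
        refine sum_congr ?_ fun A _ => by simp
        ext A; simp
    _ = ∑ A : Finset V, q ^ #A * (#{o ∈ acyclicOrientations r | A ⊆ sinks o} : R) := by
        rw [sum_comm]
        refine sum_congr rfl fun A _ => ?_
        rw [← sum_filter, sum_const, nsmul_eq_mul, mul_comm]
    _ = _ := by
        rw [sum_filter]
        refine sum_congr rfl fun A _ => ?_
        split_ifs with hA
        · rw [card_filter_subset_sinks hr hA]
        · rw [filter_eq_empty_iff.2, card_empty, Nat.cast_zero, mul_zero]
          refine fun o ho h => hA ?_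
          simp only [acyclicOrientations, mem_filter, mem_univ, true_and] at ho
          exact isStable_of_subset_sinks ho h

theorem sinks_nonempty [Nonempty V] {r o : V → V → Prop} (ho : IsAcyclicOrientation r o) :
    (sinks o).Nonempty := by
  -- a maximal vertex for reachability is a sink
  let t : V → V → Prop := fun u v => Relation.TransGen o v u
  have : IsTrans V t := ⟨fun _ _ _ h₁ h₂ => h₂.trans h₁⟩
  have : Std.Irrefl t := ⟨ho.acyclic⟩
  obtain ⟨v, -, hv⟩ := (Finite.wellFounded_of_trans_of_irrefl t).has_min Set.univ
    Set.univ_nonempty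
  exact ⟨v, by simpa [sinks] using fun u h => hv u trivial (.single h)⟩

end Orientations

/-! ### The expansion over edge sets -/

section Expansion

variable {V : Type*} [Fintype V]

/-- Related vertices get different colors. -/
def IsProper {I : Type*} (r : V → V → Prop) (κ : V → I) : Prop :=
  ∀ u v, r u v → κ u ≠ κ v

/-- The connected components of the graph on `V` with edge set `S`. -/
abbrev Component (S : Finset (V × V)) : Type _ :=
  Quot fun u v : V => (u, v) ∈ S

instance (S : Finset (V × V)) : Fintype (Component S) :=
  Fintype.ofFinite _

/-- The number of vertices of a component. -/
def componentSize {S : Finset (V × V)} (c : Component S) : ℕ+ :=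
  ⟨#{v : V | Quot.mk _ v = c}, by
    obtain ⟨v, rfl⟩ := Quot.exists_rep c
    exact card_pos.2 ⟨v, by simp⟩⟩

/-- The set of pairs related by `r`. -/
def edgePairs (r : V → V → Prop) : Finset (V × V) :=
  univ.filter fun e => r e.1 e.2

/-- The polynomial that expresses the chromatic symmetric function of `r` in the power sums:
`∑ S, (-1) ^ |S| ∏ c, p_{|c|}`, where `S` runs over the sets of edges and `c` over the components
of `S`. -/
def powerSumPoly (r : V → V → Prop) : MvPolynomial ℕ+ ℚ :=
  ∑ S ∈ (edgePairs r).powerset, (-1) ^ #S * ∏ c : Component S, X (componentSize c)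

/-- Inclusion-exclusion over the edges that are monochromatic. -/
theorem sum_isProper {I R : Type*} [CommRing R] (r : V → V → Prop) (K : Finset (V → I))
    (f : (V → I) → R) :
    ∑ κ ∈ K with IsProper r κ, f κ =
      ∑ S ∈ (edgePairs r).powerset, (-1) ^ #S * ∑ κ ∈ K with ∀ e ∈ S, κ e.1 = κ e.2, f κ := by
  simp_rw [mul_sum, sum_filter]
  rw [sum_comm]
  refine sum_congr rfl fun κ _ => ?_
  have h := congrArg (Int.cast : ℤ → R)
    (sum_powerset_neg_one_pow_card (x := {e ∈ edgePairs r | κ e.1 = κ e.2}))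
  have hp : ({e ∈ edgePairs r | κ e.1 = κ e.2} = ∅) ↔ IsProper r κ := by
    simp [filter_eq_empty_iff, edgePairs, IsProper]
  push_cast at h
  simp_rw [hp] at h
  calc (if IsProper r κ then f κ else 0) = (if IsProper r κ then 1 else 0) * f κ := by simp
    _ = ∑ S ∈ (edgePairs r).powerset with ∀ e ∈ S, κ e.1 = κ e.2, (-1) ^ #S * f κ := by
        rw [← h, sum_mul]
        refine sum_congr ?_ fun _ _ => rfl
        ext S
        simp only [mem_powerset, mem_filter, subset_iff]
        exact ⟨fun h => ⟨fun e he => (h he).1, fun e he => (h he).2⟩,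
          fun h e he => ⟨h.1 he, h.2 e he⟩⟩
    _ = _ := sum_filter _ _

/-- Colorings that are constant on the edges in `S` are colorings of the components of `S`. -/
def componentColoringEquiv (S : Finset (V × V)) (I : Type*) :
    (Component S → I) ≃ {κ : V → I // ∀ e ∈ S, κ e.1 = κ e.2} where
  toFun k := ⟨fun v => k (Quot.mk _ v), fun e he => congrArg k (Quot.sound he)⟩
  invFun κ := Quot.lift κ.1 fun u v h => κ.2 (u, v) h
  left_inv k := by
    ext c
    obtain ⟨v, rfl⟩ := Quot.exists_rep c
    rfl
  right_inv κ := rfl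

theorem prod_comp_component {M : Type*} [CommMonoid M] (S : Finset (V × V))
    (f : Component S → M) : ∏ v, f (Quot.mk _ v) = ∏ c, f c ^ (componentSize c : ℕ) := by
  rw [← prod_fiberwise univ (fun v => (Quot.mk _ v : Component S))]
  refine prod_congr rfl fun c _ => ?_
  rw [prod_congr rfl fun v hv => by rw [(mem_filter.1 hv).2], prod_const]
  rfl

/-- The polynomial `powerSumPoly r`, evaluated at the power sums of finitely many elements `y i`,
counts the proper colorings with colors `i` of weight `y i`. -/
theorem aeval_powerSumPoly {I R : Type*} [Fintype I] [CommRing R] [Algebra ℚ R]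
    (r : V → V → Prop) (y : I → R) :
    aeval (fun a : ℕ+ => ∑ i, y i ^ (a : ℕ)) (powerSumPoly r) =
      ∑ κ : V → I with IsProper r κ, ∏ v, y (κ v) := by
  rw [sum_isProper, powerSumPoly, map_sum]
  refine sum_congr rfl fun S _ => ?_
  simp only [map_mul, map_pow, map_neg, map_one, map_prod, aeval_X]
  congr 1
  rw [prod_univ_sum, Fintype.piFinset_univ, ← sum_subtype_eq_sum_filter, subtype_univ,
    ← (componentColoringEquiv S I).sum_comp]
  exact sum_congr rfl fun k _ => (prod_comp_component S fun c => y (k c)).symm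

end Expansion

/-! ### Splitting off one color -/

section Splitting

variable {V : Type*} [Fintype V]

/-- The colorings with color set `Option J` that use the extra color exactly on `A`. -/
def optionColoring {J : Type*} (A : Finset V) (κ : {v // v ∉ A} → J) (v : V) : Option J :=
  if hv : v ∉ A then some (κ ⟨v, hv⟩) else none

/-- Proper colorings with an extra color, sorted by the set `A` of vertices of this color. -/
theorem sum_isProper_option {J R : Type*} [Fintype J] [CommRing R] (r : V → V → Prop)
    (y : Option J → R) :
    ∑ κ : V → Option J with IsProper r κ, ∏ v, y (κ v) =
      ∑ A : Finset V with IsStable r A, y none ^ #A *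
        ∑ κ : {v // v ∉ A} → J with IsProper (deleteSet r A) κ, ∏ v, y (some (κ v)) := by
  simp_rw [mul_sum]
  rw [sum_sigma']
  symm
  refine sum_bij' (fun p _ => optionColoring p.1 p.2)
    (fun κ _ => ⟨univ.filter fun v => κ v = none, fun v =>
      (κ v).get (Option.isSome_iff_ne_none.2 (by simpa using v.2))⟩) ?_ ?_ ?_ ?_ ?_
  · rintro ⟨A, κ⟩ h
    simp only [mem_sigma, mem_filter, mem_univ, true_and] at h ⊢
    intro u v huv
    by_cases hu : u ∈ A <;> by_cases hv : v ∈ A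
    · exact (h.1 u hu v hv huv).elim
    · simp [optionColoring, hu, hv]
    · simp [optionColoring, hu, hv]
    · simpa [optionColoring, hu, hv] using h.2 ⟨u, hu⟩ ⟨v, hv⟩ huv
  · intro κ h
    simp only [mem_sigma, mem_filter, mem_univ, true_and] at h ⊢
    refine ⟨fun u hu v hv huv => h u v huv ?_, fun u v huv he => h u v huv ?_⟩
    · simp only [mem_filter, mem_univ, true_and] at hu hv
      rw [hu, hv]
    · exact Option.get_inj.1 he
  · rintro ⟨A, κ⟩ h
    have hA : (univ.filter fun v => optionColoring A κ v = none) = A := by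
      ext v
      by_cases hv : v ∈ A <;> simp [optionColoring, hv]
    refine Sigma.ext hA (Function.hfunext (by simp [hA]) ?_)
    rintro ⟨v, hv⟩ ⟨w, hw⟩ he
    obtain rfl : v = w := (Subtype.heq_iff_coe_eq (by simp [hA])).1 he
    simp [optionColoring, hw]
  · intro κ h
    ext1 v
    by_cases hv : κ v = none
    · simp [optionColoring, hv]
    · simp [optionColoring, hv]
  · rintro ⟨A, κ⟩ h
    rw [← prod_mul_prod_compl A, ← prod_const]
    congr 1
    · exact prod_congr rfl fun v hv => by simp [optionColoring, hv]
    · rw [prod_subtype (p := (· ∉ A)) Aᶜ (by simp)]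
      exact prod_congr rfl fun v _ => by simp [optionColoring, v.2]

variable {R : Type*} [CommRing R] [IsDomain R] [CharZero R] [Algebra ℚ R]

/-- For natural `z` this splits a coloring with one color of weight `q` and `z` colors of weight
`u` at the color class of weight `q`. Both sides are polynomials in `z`. -/
theorem aeval_powerSumPoly_add (r : V → V → Prop) (q u z : R) :
    aeval (fun a : ℕ+ => q ^ (a : ℕ) + z * u ^ (a : ℕ)) (powerSumPoly r) =
      ∑ A : Finset V with IsStable r A,
        q ^ #A * aeval (fun a : ℕ+ => z * u ^ (a : ℕ)) (powerSumPoly (deleteSet r A)) := by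
  -- the two sides, as polynomials in the variable `z`
  let F : Polynomial R := aeval (fun a : ℕ+ => .C (q ^ (a : ℕ)) + .X * .C (u ^ (a : ℕ)))
    (powerSumPoly r)
  let G : Polynomial R := ∑ A : Finset V with IsStable r A, .C (q ^ #A) *
    aeval (fun a : ℕ+ => .X * .C (u ^ (a : ℕ))) (powerSumPoly (deleteSet r A))
  let e (z : R) : Polynomial R →ₐ[ℚ] R := (Polynomial.aeval z).restrictScalars ℚ
  have hF (z : R) : F.eval z =
      aeval (fun a : ℕ+ => q ^ (a : ℕ) + z * u ^ (a : ℕ)) (powerSumPoly r) := by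
    change e z F = _
    rw [← AlgHom.comp_apply, comp_aeval]
    simp [e]
  have hG (z : R) : G.eval z = ∑ A : Finset V with IsStable r A,
      q ^ #A * aeval (fun a : ℕ+ => z * u ^ (a : ℕ)) (powerSumPoly (deleteSet r A)) := by
    change e z G = _
    simp only [G, map_sum, map_mul]
    refine sum_congr rfl fun A _ => ?_
    rw [← AlgHom.comp_apply, comp_aeval]
    simp [e]
  rw [← hF, ← hG]
  congr 1
  refine Polynomial.eq_of_infinite_eval_eq F G
    ((Set.infinite_range_of_injective (Nat.cast_injective (R := R))).mono ?_)
  rintro _ ⟨n, rfl⟩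
  have h₁ := aeval_powerSumPoly r fun i : Option (Fin n) => i.elim q fun _ => u
  have h₂ (A : Finset V) := aeval_powerSumPoly (deleteSet r A) fun _ : Fin n => u
  simp only [Fintype.sum_option, Option.elim_none, Option.elim_some, sum_const, card_univ,
    Fintype.card_fin, nsmul_eq_mul] at h₁ h₂
  change F.eval _ = G.eval _
  rw [hF, hG, h₁, sum_isProper_option r fun i => i.elim q fun _ => u]
  exact sum_congr rfl fun A _ => by
    rw [h₂]
    simp only [Option.elim_none, Option.elim_some, sum_const, nsmul_eq_mul]
    congr!

/-- The case `q = 0` of `aeval_powerSumPoly_add`, where only the term of the empty set survives. -/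
theorem aeval_powerSumPoly_deleteSet_empty (r : V → V → Prop) (u z : R) :
    aeval (fun a : ℕ+ => z * u ^ (a : ℕ)) (powerSumPoly (deleteSet r ∅)) =
      aeval (fun a : ℕ+ => z * u ^ (a : ℕ)) (powerSumPoly r) := by
  have h := aeval_powerSumPoly_add r 0 u z
  rw [sum_eq_single_of_mem ∅ (by simp [isStable_empty])
    fun A _ hA => by rw [zero_pow (card_ne_zero.2 (nonempty_iff_ne_empty.2 hA)), zero_mul]] at h
  simpa using h.symm

end Splitting

theorem aeval_powerSumPoly_zero {V R : Type*} [Fintype V] [CommRing R] [Algebra ℚ R]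
    (r : V → V → Prop) :
    aeval (fun _ : ℕ+ => (0 : R)) (powerSumPoly r) = if IsEmpty V then 1 else 0 := by
  have h := aeval_powerSumPoly r fun i : Fin 0 => (i.elim0 : R)
  simp only [univ_eq_empty, sum_empty] at h
  rw [h]
  split_ifs with hV
  · rw [filter_true_of_mem fun κ _ u => hV.elim u]
    simp
  · rw [not_isEmpty_iff] at hV
    rw [univ_eq_empty, filter_empty, sum_empty]

/-- The number of acyclic orientations: both sides satisfy the same recursion over the removal of
stable sets, by `sum_add_one_pow_card_sinks` and `aeval_powerSumPoly_add` for `q = -1`, as a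
nonempty acyclic graph has a sink. -/
theorem aeval_powerSumPoly_neg_one {R : Type*} [CommRing R] [IsDomain R] [CharZero R]
    [Algebra ℚ R] {V : Type*} [Fintype V] {r : V → V → Prop} (hr : ∀ u v, r u v → r v u) :
    aeval (fun a : ℕ+ => (-1 : R) * (-1) ^ (a : ℕ)) (powerSumPoly r) =
      #(acyclicOrientations r) := by
  induction hn : Fintype.card V using Nat.strong_induction_on generalizing V with
  | _ n ih =>
  subst hn
  have h₁ := aeval_powerSumPoly_add r (-1 : R) (-1) (-1)
  have h₂ := sum_add_one_pow_card_sinks hr (-1 : R)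
  have h₃ : ∑ o ∈ acyclicOrientations r, (-1 + 1 : R) ^ #(sinks o) =
      if IsEmpty V then 1 else 0 := by
    split_ifs with hV
    · have hc : acyclicOrientations r = {r} := by
        ext o
        have : o = r := Subsingleton.elim _ _
        subst this
        simp only [acyclicOrientations, mem_filter, mem_univ, true_and, mem_singleton, iff_true]
        exact ⟨fun v => hV.elim v, fun v => hV.elim v, fun v => hV.elim v⟩
      rw [hc, sum_singleton, Finset.eq_empty_of_isEmpty (sinks r), card_empty, pow_zero]
    · rw [not_isEmpty_iff] at hV
      refine sum_eq_zero fun o ho => ?_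
      simp only [acyclicOrientations, mem_filter, mem_univ, true_and] at ho
      rw [neg_add_cancel, zero_pow (card_ne_zero.2 (sinks_nonempty ho))]
  simp only [neg_one_mul, add_neg_cancel, aeval_powerSumPoly_zero] at h₁
  rw [h₃, h₁] at h₂
  -- the terms for `A ≠ ∅` agree by induction, hence so do the terms for `A = ∅`
  have h0 : (∅ : Finset V) ∈ ({A | IsStable r A} : Finset (Finset V)) := by
    simp [isStable_empty]
  rw [← sum_erase_add _ _ h0, ← sum_erase_add (a := ∅) _ _ h0] at h₂
  have h₄ : ∀ A ∈ ({A | IsStable r A} : Finset (Finset V)).erase ∅,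
      (-1 : R) ^ #A * aeval (fun a : ℕ+ => -(-1 : R) ^ (a : ℕ)) (powerSumPoly (deleteSet r A)) =
        (-1) ^ #A * #(acyclicOrientations (deleteSet r A)) := by
    intro A hA
    congr 1
    simp only [← ih (Fintype.card {v // v ∉ A}) (by
      obtain ⟨v, hv⟩ := nonempty_iff_ne_empty.2 (ne_of_mem_erase hA)
      exact Fintype.card_subtype_lt (x := v) (by simpa using hv))
      (r := deleteSet r A) (fun u v => hr u v) rfl, neg_one_mul]
  rw [sum_congr rfl h₄] at h₂
  have h₅ := add_left_cancel h₂
  simp only [card_empty, pow_zero, one_mul, ← neg_one_mul (_ ^ _ : R)] at h₅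
  rw [aeval_powerSumPoly_deleteSet_empty] at h₅
  rw [h₅, ← card_filter_subset_sinks hr (isStable_empty r)]
  simp

/-- The substitution that turns the power sums `p_a` into `(t - 1) ^ a - (-1) ^ a` turns the
chromatic symmetric function into the generating function of acyclic orientations by sinks. -/
theorem aeval_powerSumPoly_sinks {R : Type*} [CommRing R] [IsDomain R] [CharZero R]
    [Algebra ℚ R] {V : Type*} [Fintype V] {r : V → V → Prop} (hr : ∀ u v, r u v → r v u) (t : R) :
    aeval (fun a : ℕ+ => (t - 1) ^ (a : ℕ) - (-1) ^ (a : ℕ)) (powerSumPoly r) =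
      ∑ o ∈ acyclicOrientations r, t ^ #(sinks o) := by
  have h := aeval_powerSumPoly_add r (t - 1) (-1) (-1)
  have h' := sum_add_one_pow_card_sinks hr (t - 1)
  rw [sub_add_cancel] at h'
  simp only [neg_one_mul, ← sub_eq_add_neg] at h
  rw [h, h']
  refine sum_congr rfl fun A _ => ?_
  rw [← aeval_powerSumPoly_neg_one (r := deleteSet r A) fun u v => hr u v]
  simp only [neg_one_mul]

/-! ### Power sums in infinitely many variables -/

theorem finite_setOf_sum_single_eq {ι : Type*} [Fintype ι] (w : ι → ℕ+) (m : ℕ →₀ ℕ) :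
    {κ : ι → ℕ | ∑ i, Finsupp.single (κ i) (w i : ℕ) = m}.Finite := by
  refine (Set.Finite.pi' fun _ : ι => m.support.finite_toSet).subset fun κ hκ i => ?_
  simp only [Set.mem_ofPred_eq] at hκ
  subst hκ
  simp only [mem_coe, Finsupp.mem_support_iff, Finsupp.finsetSum_apply]
  exact (sum_pos' (fun _ _ => Nat.zero_le _) ⟨i, mem_univ i, by simp⟩).ne'

/-- The coefficients of a product of power sums count the maps that assign to every factor one of
the variables. -/
theorem coeff_prod_powerSumSeries {ι : Type*} [Fintype ι] (w : ι → ℕ+) (m : ℕ →₀ ℕ) :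
    MvPowerSeries.coeff m (∏ i, powerSumSeries (w i)) =
      (Nat.card {κ : ι → ℕ // ∑ i, Finsupp.single (κ i) (w i : ℕ) = m} : ℚ) := by
  have hfin (i : ι) (l : ℕ →₀ ℕ) : Finite {j : ℕ // Finsupp.single j (w i : ℕ) = l} := by
    refine Finite.of_injective (β := Unit) (fun _ => ()) fun ⟨a, ha⟩ ⟨b, hb⟩ _ => ?_
    simpa using (Finsupp.single_left_inj (w i).ne_zero).1 (ha.trans hb.symm)
  rw [MvPowerSeries.coeff_prod]
  calc ∑ l ∈ finsuppAntidiag univ m, ∏ i, MvPowerSeries.coeff (l i) (powerSumSeries (w i))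
      = ∑ l : finsuppAntidiag (univ : Finset ι) m,
          (Nat.card (∀ i, {j : ℕ // Finsupp.single j (w i : ℕ) = l.1 i}) : ℚ) := by
        rw [← sum_coe_sort]
        refine sum_congr rfl fun l _ => ?_
        rw [Nat.card_pi, Nat.cast_prod]
        rfl
    _ = _ := by
        rw [← Nat.cast_sum, ← Nat.card_sigma]
        congr 1
        refine Nat.card_congr
          { toFun p := ⟨fun i => p.2 i, ?_⟩
            invFun κ := ⟨⟨Finsupp.equivFunOnFinite.symm fun i => Finsupp.single (κ.1 i) (w i : ℕ),
              ?_⟩, fun i => ⟨κ.1 i, rfl⟩⟩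
            left_inv := ?_
            right_inv _ := rfl }
        · obtain ⟨⟨l, hl⟩, k⟩ := p
          exact (sum_congr rfl fun i _ => (k i).2).trans (mem_finsuppAntidiag.1 hl).1
        · simpa [mem_finsuppAntidiag] using κ.2
        · rintro ⟨⟨l, hl⟩, k⟩
          refine Sigma.ext (Subtype.ext (Finsupp.ext fun i => (k i).2)) ?_
          refine Function.hfunext rfl fun i j hij => ?_
          obtain rfl := eq_of_heq hij
          exact (Subtype.heq_iff_coe_eq fun x => by
            simp [(k i).2]).2 rfl

theorem exists_eq_sum_single (m : ℕ+ →₀ ℕ) :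
    ∃ w : Fin m.degree → ℕ+, m = ∑ i, Finsupp.single (w i) 1 := by
  suffices h : ∃ (d : ℕ) (w : Fin d → ℕ+), m = ∑ i, Finsupp.single (w i) 1 by
    obtain ⟨d, w, hw⟩ := h
    have : m.degree = d := by
      rw [hw, map_sum]
      simp
    subst this
    exact ⟨w, hw⟩
  induction m using Finsupp.induction_linear with
  | zero => exact ⟨0, Fin.elim0, by simp⟩
  | add f g hf hg =>
    obtain ⟨d, w, rfl⟩ := hf
    obtain ⟨d', w', rfl⟩ := hg
    exact ⟨d + d', Fin.append w w', by simp [Fin.sum_univ_add]⟩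
  | single a n => exact ⟨n, fun _ => a, by simp⟩

/-- If the variables `x_i` to the powers `w i` occur in the product of at most as many power sums
`p_{w' j}`, then these are the power sums `p_{w i}`. -/
theorem sum_single_eq_of_sum_single_eq {d d' : ℕ} (hd : d' ≤ d) {w : Fin d → ℕ+}
    {w' : Fin d' → ℕ+} {κ : Fin d' → ℕ}
    (h : ∑ j, Finsupp.single (κ j) (w' j : ℕ) = ∑ i : Fin d, Finsupp.single (i : ℕ) (w i : ℕ)) :
    ∑ j, Finsupp.single (w' j) 1 = ∑ i, Finsupp.single (w i) 1 := by
  -- every variable `x_i` with `i < d` has to be hit by `κ`, so `κ` is a bijection onto `Fin d`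
  have hM (i : Fin d) : (∑ i : Fin d, Finsupp.single (i : ℕ) (w i : ℕ)) (i : ℕ) = w i := by
    simp [Finsupp.finsetSum_apply, Finsupp.single_apply, Fin.val_inj]
  have hκ (j : Fin d') : κ j < d := by
    by_contra! hj
    have h₀ := DFunLike.congr_fun h (κ j)
    have h₁ : (∑ i : Fin d, Finsupp.single (i : ℕ) (w i : ℕ)) (κ j) = 0 := by
      rw [Finsupp.finsetSum_apply]
      exact sum_eq_zero fun i _ => Finsupp.single_eq_of_ne (by omega)
    rw [h₁, Finsupp.finsetSum_apply] at h₀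
    simpa using sum_eq_zero_iff.1 h₀ j (mem_univ j)
  let e (j : Fin d') : Fin d := ⟨κ j, hκ j⟩
  have he : Function.Surjective e := by
    intro i
    by_contra! hi
    have h₀ := DFunLike.congr_fun h (i : ℕ)
    rw [hM, Finsupp.finsetSum_apply, sum_eq_zero fun j _ =>
      Finsupp.single_eq_of_ne fun hj => hi j (Fin.ext hj.symm)] at h₀
    exact (w i).ne_zero h₀.symm
  have hb : Function.Bijective e := he.bijective_of_nat_card_le (by simpa using hd)
  have hw (j : Fin d') : w (e j) = w' j := by
    have h₀ := DFunLike.congr_fun h (e j : ℕ)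
    rw [hM, Finsupp.finsetSum_apply, sum_eq_single_of_mem j (mem_univ j) fun k _ hk =>
      Finsupp.single_eq_of_ne fun hj => hk (hb.1 (Fin.ext hj.symm))] at h₀
    exact PNat.coe_injective (by simpa [e] using h₀.symm)
  rw [← Equiv.sum_comp (Equiv.ofBijective e hb) fun i => Finsupp.single (w i) 1]
  simp [hw]

/-- The power sums are algebraically independent: among the monomials of highest degree of a
nonzero polynomial, `∏ i, p_{w i}` is the only one in which `∏ i, x_i ^ w i` occurs, and no monomial
of lower degree contributes to it. -/
theorem aeval_powerSumSeries_injective :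
    Function.Injective (aeval (R := ℚ) fun a : ℕ+ => powerSumSeries a) := by
  rw [injective_iff_map_eq_zero]
  intro P hP
  by_contra hne
  obtain ⟨m, hm, hmax⟩ := exists_max_image P.support Finsupp.degree (support_nonempty.2 hne)
  obtain ⟨w, hw⟩ := exists_eq_sum_single m
  let M : ℕ →₀ ℕ := ∑ i : Fin m.degree, Finsupp.single (i : ℕ) (w i : ℕ)
  have hterm {d : ℕ} (w' : Fin d → ℕ+) (m' : ℕ+ →₀ ℕ)
      (hw' : m' = ∑ j, Finsupp.single (w' j) 1) :
      aeval (R := ℚ) (fun a : ℕ+ => powerSumSeries a) (monomial m' 1) =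
        ∏ j, powerSumSeries (w' j) := by
    rw [hw', monomial_sum_one, map_prod]
    exact prod_congr rfl fun j _ => aeval_X _ _
  have hzero : ∀ m' ∈ P.support, m' ≠ m → MvPowerSeries.coeff M
      (aeval (R := ℚ) (fun a : ℕ+ => powerSumSeries a) (monomial m' 1)) = 0 := by
    intro m' hm' hne'
    obtain ⟨w', hw'⟩ := exists_eq_sum_single m'
    rw [hterm w' m' hw', coeff_prod_powerSumSeries, Nat.cast_eq_zero, Nat.card_eq_zero]
    refine .inl ⟨fun ⟨κ, hκ⟩ => hne' (hw'.trans (.trans ?_ hw.symm))⟩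
    exact sum_single_eq_of_sum_single_eq (hmax m' hm') hκ
  have hpos : MvPowerSeries.coeff M
      (aeval (R := ℚ) (fun a : ℕ+ => powerSumSeries a) (monomial m 1)) ≠ 0 := by
    rw [hterm w m hw, coeff_prod_powerSumSeries, Nat.cast_ne_zero, Nat.card_ne_zero]
    exact ⟨⟨⟨fun i => i, rfl⟩⟩, finite_setOf_sum_single_eq w M⟩
  have h := congrArg (MvPowerSeries.coeff M) hP
  have hP' : P = ∑ m' ∈ P.support, P.coeff m' • monomial m' 1 := by
    conv_lhs => rw [P.as_sum]
    simp [smul_monomial]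
  rw [hP'] at h
  simp only [map_sum, map_smul, map_zero] at h
  rw [sum_eq_single_of_mem m hm fun m' hm' hne' => by rw [hzero m' hm' hne', smul_zero]] at h
  exact (smul_ne_zero (mem_support_iff.1 hm) hpos) h

/-- The expansion of the chromatic symmetric function of a relation in the power sums. -/
theorem coeff_aeval_powerSumPoly {V : Type*} [Fintype V] (r : V → V → Prop) (m : ℕ →₀ ℕ) :
    MvPowerSeries.coeff m (aeval (fun a : ℕ+ => powerSumSeries a) (powerSumPoly r)) =
      (Nat.card {κ : V → ℕ // IsProper r κ ∧ ∑ v, Finsupp.single (κ v) 1 = m} : ℚ) := by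
  have hfin : {κ : V → ℕ | ∑ v, Finsupp.single (κ v) 1 = m}.Finite :=
    finite_setOf_sum_single_eq (fun _ => 1) m
  have hcard : (Nat.card {κ : V → ℕ // IsProper r κ ∧ ∑ v, Finsupp.single (κ v) 1 = m} : ℚ) =
      ∑ κ ∈ hfin.toFinset with IsProper r κ, 1 := by
    rw [sum_const, nsmul_one, ← Nat.subtype_card]
    simp [and_comm]
  rw [hcard, sum_isProper, powerSumPoly, map_sum, map_sum]
  refine sum_congr rfl fun S _ => ?_
  have hsign : (aeval (fun a : ℕ+ => powerSumSeries a)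
      ((-1) ^ #S * ∏ c : Component S, X (componentSize c) : MvPolynomial ℕ+ ℚ)) =
      ((-1) ^ #S : ℚ) • ∏ c : Component S, powerSumSeries (componentSize c) := by
    simp only [map_mul, map_pow, map_neg, map_one, map_prod, aeval_X, Algebra.smul_def]
  rw [hsign, map_smul, smul_eq_mul, coeff_prod_powerSumSeries, sum_const, nsmul_one]
  congr 2
  rw [← Nat.subtype_card (p := fun κ : V → ℕ => (∀ e ∈ S, κ e.1 = κ e.2) ∧
    ∑ v, Finsupp.single (κ v) 1 = m) _ (by simp [and_comm])]
  refine Nat.card_congr (((componentColoringEquiv S ℕ).subtypeEquiv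
    (q := fun κ => ∑ v, Finsupp.single (κ.1 v) 1 = m) fun k => ?_).trans
      (Equiv.subtypeSubtypeEquivSubtypeInter _ fun κ : V → ℕ =>
        ∑ v, Finsupp.single (κ v) 1 = m))
  have h := prod_comp_component S fun c => Multiplicative.ofAdd (Finsupp.single (k c) 1)
  simp only [← ofAdd_nsmul, ← ofAdd_sum, Finsupp.smul_single, smul_eq_mul, mul_one,
    EmbeddingLike.apply_eq_iff_eq] at h
  rw [← h]
  rfl

/-! ### Change of generators -/

/-- The linear map that identifies the polynomials `f(t)`, up to constants, with the linear forms
in the generators: `t ^ n ↦ X n` for `n ≥ 1`, and `1 ↦ 0`. Under this identification the passage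
between power sums and `ζ`'s is the translation of `t` by one. -/
def linearForm : Polynomial ℚ →ₗ[ℚ] MvPolynomial ℕ+ ℚ :=
  Polynomial.lsum fun n => LinearMap.toSpanSingleton ℚ _ (if n = 0 then 0 else X n.toPNat')

theorem linearForm_X_pow (n : ℕ+) : linearForm (Polynomial.X ^ (n : ℕ)) = X n := by
  simp [linearForm, Polynomial.lsum_apply, Polynomial.X_pow_eq_monomial]

theorem linearForm_C (c : ℚ) : linearForm (Polynomial.C c) = 0 := by
  simp [linearForm, Polynomial.lsum_apply, ← Polynomial.monomial_zero_left]

theorem linearMap_ext_of_X_pow {M : Type*} [AddCommGroup M] [Module ℚ M]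
    {f g : Polynomial ℚ →ₗ[ℚ] M} (h₀ : f 1 = g 1)
    (h : ∀ n : ℕ+, f (Polynomial.X ^ (n : ℕ)) = g (Polynomial.X ^ (n : ℕ))) (p : Polynomial ℚ) :
    f p = g p := by
  refine LinearMap.congr_fun (Polynomial.lhom_ext' fun n => LinearMap.ext_ring ?_) p
  simp only [LinearMap.comp_apply, Polynomial.monomial_one_right_eq_X_pow]
  obtain rfl | hn := n.eq_zero_or_pos
  · simpa using h₀
  · exact h ⟨n, hn⟩

/-- The substitution of `(t + c) ^ n`, read as a linear form, for the `n`-th generator. -/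
def shift (c : ℚ) : MvPolynomial ℕ+ ℚ →ₐ[ℚ] MvPolynomial ℕ+ ℚ :=
  aeval fun n => linearForm ((Polynomial.X + Polynomial.C c) ^ (n : ℕ))

theorem shift_linearForm (c : ℚ) (p : Polynomial ℚ) :
    shift c (linearForm p) = linearForm (Polynomial.taylor c p) := by
  refine linearMap_ext_of_X_pow (f := (shift c).toLinearMap ∘ₗ linearForm)
    (g := linearForm ∘ₗ Polynomial.taylor c) ?_ (fun n => ?_) p
  · simp [← Polynomial.C_1, linearForm_C, -map_one]
  · simp [linearForm_X_pow, shift]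

theorem shift_shift_neg (c : ℚ) (P : MvPolynomial ℕ+ ℚ) : shift c (shift (-c) P) = P := by
  have h : (shift c).comp (shift (-c)) = AlgHom.id ℚ _ := by
    refine MvPolynomial.algHom_ext fun n => ?_
    have : shift (-c) (X n) = linearForm (Polynomial.taylor (-c) (Polynomial.X ^ (n : ℕ))) := by
      simp [shift]
    rw [AlgHom.comp_apply, this, shift_linearForm, Polynomial.taylor_taylor, add_neg_cancel,
      Polynomial.taylor_zero, linearForm_X_pow, AlgHom.id_apply]
  exact DFunLike.congr_fun h P

theorem aeval_zetaSeries_eq (P : MvPolynomial ℕ+ ℚ) :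
    aeval zetaSeries P = aeval (fun a : ℕ+ => powerSumSeries a) (shift 1 P) := by
  have h : aeval (R := ℚ) zetaSeries =
      (aeval fun a : ℕ+ => powerSumSeries a).comp (shift 1) := by
    refine MvPolynomial.algHom_ext fun n => ?_
    have hp (a : ℕ) (ha : a ∈ Icc 1 (n : ℕ)) : aeval (R := ℚ) (fun a : ℕ+ => powerSumSeries a)
        (linearForm (Polynomial.X ^ a)) = powerSumSeries a := by
      obtain ⟨a, rfl⟩ := CanLift.prf (β := ℕ+) a (mem_Icc.1 ha).1
      rw [linearForm_X_pow, aeval_X]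
    rw [AlgHom.comp_apply, shift, aeval_X, aeval_X, zetaSeries, Polynomial.C_1, add_pow,
      range_eq_Ico, sum_eq_sum_Ico_succ_bot (by omega), map_add, map_add]
    simp only [one_pow, mul_one, pow_zero, Nat.choose_zero_right, Nat.cast_one]
    rw [← Polynomial.C_1, linearForm_C, map_zero, zero_add, map_sum, map_sum]
    refine sum_congr (by ext; simp) fun a ha => ?_
    rw [mul_comm, ← nsmul_eq_mul, map_nsmul, map_nsmul, hp, Nat.cast_smul_eq_nsmul]
    rw [mem_Icc]
    rw [mem_Ico] at ha
    omega
  exact DFunLike.congr_fun h P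

/-- The substitution `ζ_n ↦ t ^ n` turns `p_a` into `(t - 1) ^ a - (-1) ^ a`. -/
theorem aeval_X_pow_shift_neg_one (P : MvPolynomial ℕ+ ℚ) :
    aeval (fun n : ℕ+ => (Polynomial.X : Polynomial ℚ) ^ (n : ℕ)) (shift (-1) P) =
      aeval (fun a : ℕ+ => (Polynomial.X - 1 : Polynomial ℚ) ^ (a : ℕ) - (-1) ^ (a : ℕ)) P := by
  have hlin (p : Polynomial ℚ) :
      aeval (fun n : ℕ+ => (Polynomial.X : Polynomial ℚ) ^ (n : ℕ)) (linearForm p) =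
        p - Polynomial.C (p.eval 0) := by
    refine linearMap_ext_of_X_pow
      (f := (aeval (R := ℚ) fun n : ℕ+ => (Polynomial.X : Polynomial ℚ) ^ (n : ℕ)).toLinearMap ∘ₗ
        linearForm)
      (g := LinearMap.id - (Polynomial.CAlgHom (R := ℚ) (A := ℚ)).toLinearMap ∘ₗ
        Polynomial.leval 0) ?_ (fun n => ?_) p
    · simp [← Polynomial.C_1, linearForm_C, -map_one]
    · simp [linearForm_X_pow]
  have h : (aeval (R := ℚ) fun n : ℕ+ => (Polynomial.X : Polynomial ℚ) ^ (n : ℕ)).comp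
      (shift (-1)) =
      aeval fun a : ℕ+ => (Polynomial.X - 1 : Polynomial ℚ) ^ (a : ℕ) - (-1) ^ (a : ℕ) := by
    refine MvPolynomial.algHom_ext fun n => ?_
    rw [AlgHom.comp_apply, shift, aeval_X, aeval_X, hlin]
    simp [sub_eq_add_neg]
  exact DFunLike.congr_fun h P

theorem coeffSum_eq_coeff (P : MvPolynomial ℕ+ ℚ) (k : ℕ) :
    coeffSum P k =
      (aeval (fun n : ℕ+ => (Polynomial.X : Polynomial ℚ) ^ (n : ℕ)) P).coeff k := by
  rw [aeval_def, eval₂_eq, Polynomial.finsetSum_coeff, coeffSum, sum_filter]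
  refine sum_congr rfl fun m _ => ?_
  have : ∏ i ∈ m.support, ((Polynomial.X : Polynomial ℚ) ^ (i : ℕ)) ^ m i =
      Polynomial.X ^ indexSum m := by
    rw [indexSum, Finsupp.sum, ← prod_pow_eq_pow_sum]
    exact prod_congr rfl fun i _ => by rw [← pow_mul, mul_comm]
  rw [this, Polynomial.algebraMap_eq, Polynomial.coeff_C_mul_X_pow]
  simp [eq_comm]

/-! ### Graphs -/

section Graphs

variable {α β : Type*} (G : Graph α β)

/-- Adjacency as a relation on the vertex set; a vertex with a loop is adjacent to itself. -/
def adjRel (u v : G.vertexSet) : Prop :=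
  ∃ e, G.IsLink e u v

theorem adjRel_symm (u v : G.vertexSet) (h : adjRel G u v) : adjRel G v u :=
  h.imp fun _ h => h.symm

theorem aeval_powerSumPoly_adjRel [Fintype G.vertexSet] :
    aeval (fun a : ℕ+ => powerSumSeries a) (powerSumPoly (adjRel G)) = G.chromaticSymm := by
  ext m
  rw [coeff_aeval_powerSumPoly]
  change _ = ((Nat.card _ : ℕ) : ℚ)
  congr 1
  refine Nat.card_congr (Equiv.subtypeEquivRight fun κ => and_congr_left fun _ => ?_)
  simp only [IsProper, Graph.IsProperColoring, adjRel]
  exact ⟨fun h e u v he => h u v ⟨e, he⟩, fun h u v ⟨e, he⟩ => h e u v he⟩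

theorem isAcyclicOrientation_arc {G : Graph α β} {o : G.Orientation} (ho : o.IsAcyclic) :
    IsAcyclicOrientation (adjRel G) o.Arc where
  le := by
    rintro _ _ ⟨e, rfl, rfl⟩
    exact ⟨e, o.isLink e⟩
  total u v := by
    rintro ⟨e, he⟩
    rcases he.eq_and_eq_or_eq_and_eq (o.isLink ⟨e, he.edge_mem⟩) with ⟨h₁, h₂⟩ | ⟨h₁, h₂⟩
    · exact .inl ⟨⟨e, he.edge_mem⟩, Subtype.ext h₁.symm, Subtype.ext h₂.symm⟩
    · exact .inr ⟨⟨e, he.edge_mem⟩, Subtype.ext h₂.symm, Subtype.ext h₁.symm⟩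
  acyclic := ho

theorem arc_injOn : Set.InjOn (Graph.Orientation.Arc (G := G)) {o | o.IsAcyclic} := by
  intro o ho o' _ h
  have key (e : G.edgeSet) : o.tail e = o'.tail e ∧ o.head e = o'.head e := by
    rcases (o.isLink e).eq_and_eq_or_eq_and_eq (o'.isLink e) with ⟨h₁, h₂⟩ | ⟨h₁, h₂⟩
    · exact ⟨Subtype.ext h₁, Subtype.ext h₂⟩
    · have h' : o.Arc (o'.tail e) (o'.head e) := h ▸ ⟨e, rfl, rfl⟩
      rw [← Subtype.ext h₁, ← Subtype.ext h₂] at h'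
      exact (ho _ (.tail (.single h') ⟨e, rfl, rfl⟩)).elim
  cases o
  cases o'
  simp only [Graph.Orientation.mk.injEq]
  exact ⟨funext fun e => (key e).1, funext fun e => (key e).2⟩

theorem exists_arc_eq {r : G.vertexSet → G.vertexSet → Prop}
    (hr : IsAcyclicOrientation (adjRel G) r) : ∃ o : G.Orientation, o.Arc = r := by
  have h (e : G.edgeSet) : ∃ p : G.vertexSet × G.vertexSet, G.IsLink e p.1 p.2 ∧ r p.1 p.2 := by
    obtain ⟨x, y, hxy⟩ := G.exists_isLink_of_mem_edgeSet e.2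
    rcases hr.total ⟨x, hxy.left_mem⟩ ⟨y, hxy.right_mem⟩ ⟨e, hxy⟩ with h | h
    · exact ⟨(_, _), hxy, h⟩
    · exact ⟨(_, _), hxy.symm, h⟩
  choose p hp using h
  refine ⟨⟨fun e => (p e).1, fun e => (p e).2, fun e => (hp e).1⟩, ?_⟩
  ext u v
  constructor
  · rintro ⟨e, rfl, rfl⟩
    exact (hp e).2
  · intro huv
    obtain ⟨e, he⟩ := hr.le u v huv
    have hpe := hp ⟨e, he.edge_mem⟩
    rcases he.eq_and_eq_or_eq_and_eq hpe.1 with ⟨h₁, h₂⟩ | ⟨h₁, h₂⟩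
    · exact ⟨⟨e, he.edge_mem⟩, Subtype.ext h₁.symm, Subtype.ext h₂.symm⟩
    · rw [← Subtype.ext h₁, ← Subtype.ext h₂] at hpe
      exact (hr.acyclic u (.tail (.single huv) hpe.2)).elim

/-- In an acyclic orientation parallel edges have the same direction, so that it is determined by
its arcs. -/
theorem acyclicOrientationCount_eq [Fintype G.vertexSet] (k : ℕ) :
    G.acyclicOrientationCount k = #{o ∈ acyclicOrientations (adjRel G) | #(sinks o) = k} := by
  have hs (o : G.Orientation) : Nat.card {v // o.IsSink v} = #(sinks o.Arc) := by
    refine Nat.subtype_card _ fun v => ?_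
    simp only [mem_sinks, Graph.Orientation.Arc, Graph.Orientation.IsSink]
    exact ⟨fun h e he => h _ ⟨e, he, rfl⟩, fun h u ⟨e, he, _⟩ => h e he⟩
  rw [← Nat.subtype_card (p := fun o => IsAcyclicOrientation (adjRel G) o ∧ #(sinks o) = k) _
    (by simp [acyclicOrientations])]
  refine Nat.card_congr (Equiv.ofBijective (fun o =>
    ⟨o.1.Arc, isAcyclicOrientation_arc o.2.1, (hs o.1).symm.trans o.2.2⟩) ⟨?_, ?_⟩)
  · intro o o' h
    exact Subtype.ext (arc_injOn G o.2.1 o'.2.1 (congrArg Subtype.val h))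
  · rintro ⟨r, hr, hk⟩
    obtain ⟨o, rfl⟩ := exists_arc_eq G hr
    exact ⟨⟨o, hr.acyclic, (hs o).trans hk⟩, rfl⟩

end Graphs

end

end Chromatic

/-! ### Coefficient sums count acyclic orientations -/

theorem mainTheorem4 {α β : Type*} (G : Graph α β) [Fintype G.vertexSet] [Finite G.edgeSet] :
    (∃! P : MvPolynomial ℕ+ ℚ, MvPolynomial.aeval zetaSeries P = G.chromaticSymm) ∧
      ∀ P : MvPolynomial ℕ+ ℚ, MvPolynomial.aeval zetaSeries P = G.chromaticSymm →
        ∀ k : ℕ, (G.acyclicOrientationCount k : ℚ) = coeffSum P k := by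
  have key (P : MvPolynomial ℕ+ ℚ) : MvPolynomial.aeval zetaSeries P = G.chromaticSymm ↔
      P = Chromatic.shift (-1) (Chromatic.powerSumPoly (Chromatic.adjRel G)) := by
    rw [Chromatic.aeval_zetaSeries_eq, ← Chromatic.aeval_powerSumPoly_adjRel,
      Chromatic.aeval_powerSumSeries_injective.eq_iff]
    constructor
    · intro h
      rw [← h]
      simpa using (Chromatic.shift_shift_neg (-1) P).symm
    · rintro rfl
      exact Chromatic.shift_shift_neg 1 _
  refine ⟨⟨_, (key _).2 rfl, fun P => (key P).1⟩, fun P hP k => ?_⟩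
  rw [(key P).1 hP, Chromatic.coeffSum_eq_coeff, Chromatic.aeval_X_pow_shift_neg_one,
    Chromatic.aeval_powerSumPoly_sinks (Chromatic.adjRel_symm G), Polynomial.finsetSum_coeff,
    Chromatic.acyclicOrientationCount_eq]
  simp only [Polynomial.coeff_X_pow, Finset.sum_boole, eq_comm]
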